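/- \textbf{Theorem.} Let $X\in\mathbb{R}^{N\times d}$ be a data matrix with $N\ge 1$, and let $X=U\Sigma V^{\mathsf T}$ be a singular value decomposition (thin, full, or of an intermediate shape): $U$ and $V$ have orthonormal columns, $\Sigma$ is (rectangular) diagonal, and the singular values $\sigma_1\ge\sigma_2\ge\dots\ge 0$ are in decreasing order, with $\sigma_i=0$ beyond the size of $\Sigma$. Let $k\ge 1$ be at most the number of columns of $V$, let $V_k\in\mathbb{R}^{d\times k}$ consist of the first $k$ columns of $V$, and let $\ell^k_j=\sum_{i=1}^k V_{j,i}^2$, $j\in[d]=\{1,\dots,d\}$, be the $k$-leverage scores. Let $y=Xw^*+\xi\in\mathbb{R}^N$ with $w^*\in\mathbb{R}^d$ and $\xi_1,\dots,\xi_N$ i.i.d. with mean $0$ and (finite) variance $v$. The excess risk of an estimator $w=w(X,y)$ is $\mathcal{E}(w)=\mathbb{E}_\xi\big[\|Xw^*-Xw\|^2/N\big]$, where $\|\cdot\|$ is the Euclidean norm. For $S\subset[d]$ with sampling matrix $\mathbf{S}$ (that is, $M\mathbf{S}=M_{:,S}$ for every matrix $M$ with $d$ columns), the sketched least-squares estimator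 is $\hat w_S=\mathbf{S}(X\mathbf{S})^{+}y\in\mathbb{R}^d$, where ${}^+$ is the Moore--Penrose pseudo-inverse. Let $\theta>1$, let $\pi$ be a permutation of $[d]$ with $\ell^k_{\pi_1}\ge\dots\ge\ell^k_{\pi_d}$, and let $$p_{\mathrm{eff}}(\theta)=\min\Big\{q\in[d]\;:\;\sum_{i\le q}\ell^k_{\pi_i}\ge k-1+\frac1\theta\Big\}.$$ Let $S$ be a random subset of $[d]$ drawn from the projection DPP with marginal kernel $K=V_kV_k^{\mathsf T}$, i.e. $\mathbb{P}(T\subset S)=\det\big[(K_{i,j})_{i,j\in T}\big]$ for all $T\subset[d]$, and let $$\mathcal{A}_\theta=\big\{S\cap\{\pi_i : p_{\mathrm{eff}}(\theta)<i\le d\}=\emptyset\big\}.$$ Then $\mathbb{P}_{\mathrm{DPP}}(\mathcal{A}_\theta)>0$, and $$\mathbb{E}_{\mathrm{DPP}}\big[\mathcal{E}(\hat w_S)\,\big|\,\mathcal{A}_\theta\big]\;\le\;\big[1+(k-1+\theta)(p_{\mathrm{eff}}(\theta)-k+1)\big]\frac{\|w^*\|^2\sigma_{k+1}^2}{N}+\frac{vk}{N}.$$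 -/

import Mathlib

open Matrix MeasureTheory ProbabilityTheory

noncomputable section

namespace ColumnSubset

/-- The rectangular diagonal `n × m` matrix with diagonal entries `σ 0, σ 1, …`. -/
def rectDiagonal (n m : ℕ) (σ : ℕ → ℝ) : Matrix (Fin n) (Fin m) ℝ :=
  Matrix.of fun i j => if (i : ℕ) = (j : ℕ) then σ i else 0

/-- `X = U Σ Vᵀ` is a singular value decomposition of the real `N × d` matrix `X`: `U` and `V` have
orthonormal columns and the singular values `σ 0 ≥ σ 1 ≥ …` are nonnegative, so that the
`(i + 1)`-st singular value of `X` is `σ i` (equal to `0` beyond the size of `Σ`).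
The thin decomposition is the case `n = m = rank X`, the full one the case `n = N`, `m = d`. -/
structure IsSVD {N d n m : ℕ} (X : Matrix (Fin N) (Fin d) ℝ)
    (U : Matrix (Fin N) (Fin n) ℝ) (σ : ℕ → ℝ) (V : Matrix (Fin d) (Fin m) ℝ) : Prop where
  orthonormal_left : Uᵀ * U = 1
  orthonormal_right : Vᵀ * V = 1
  decomposition : X = U * rectDiagonal n m σ * Vᵀ
  antitone : Antitone σ
  nonneg : ∀ i, 0 ≤ σ i
  eq_zero : ∀ i, min n m ≤ i → σ i = 0

/-- The first `k` columns `V_k` of `V`. -/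
def firstCols {d m k : ℕ} (V : Matrix (Fin d) (Fin m) ℝ) (hk : k ≤ m) :
    Matrix (Fin d) (Fin k) ℝ :=
  V.submatrix id (Fin.castLE hk)

/-- The `k`-leverage score of index `j`: the squared Euclidean norm of the `j`-th row of `V_k`. -/
def leverage {d k : ℕ} (Vk : Matrix (Fin d) (Fin k) ℝ) (j : Fin d) : ℝ :=
  ∑ i, Vk j i ^ 2

/-- The effective sparsity level: the least `q ∈ {1, …, d}` such that the first `q` of the scores
`ℓ (π 0), ℓ (π 1), …` sum to at least `k - 1 + 1/θ`. -/
def effSparsity {d : ℕ} (k : ℕ) (ℓ : Fin d → ℝ) (π : Equiv.Perm (Fin d)) (θ : ℝ) : ℕ :=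
  sInf {q : ℕ | 1 ≤ q ∧ q ≤ d ∧
    (k : ℝ) - 1 + 1 / θ ≤ ∑ i ∈ Finset.univ.filter (fun i : Fin d => (i : ℕ) < q), ℓ (π i)}

/-- The indices that `π` ranks strictly after the first `q` ones. -/
def tail {d : ℕ} (π : Equiv.Perm (Fin d)) (q : ℕ) : Finset (Fin d) :=
  (Finset.univ.filter (fun i : Fin d => q ≤ (i : ℕ))).map π.toEmbedding

/-- The random subset `Y` of `[d]` is a determinantal point process with marginal kernel `K`. -/
structure IsDPP {Ω : Type*} [MeasurableSpace Ω] (P : Measure Ω) {d : ℕ}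
    (K : Matrix (Fin d) (Fin d) ℝ) (Y : Ω → Finset (Fin d)) : Prop where
  measurable : Measurable Y
  marginal : ∀ S : Finset (Fin d), P.real {ω | S ⊆ Y ω} =
    (K.submatrix (fun i : S => (i : Fin d)) (fun i : S => (i : Fin d))).det

/-- The Moore–Penrose pseudo-inverse `A⁺ = (AᵀA)⁺ Aᵀ` of a real matrix, where `(AᵀA)⁺` inverts the
nonzero eigenvalues of `AᵀA` in an orthonormal eigenbasis (recall `0⁻¹ = 0`). -/
def pinv {m n : Type*} [Fintype m] [Fintype n] [DecidableEq n] (A : Matrix m n ℝ) :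
    Matrix n m ℝ :=
  let hA : (Aᵀ * A).IsHermitian := isHermitian_conjTranspose_mul_self A
  (hA.eigenvectorUnitary : Matrix n n ℝ) * diagonal (fun i => (hA.eigenvalues i)⁻¹) *
    (hA.eigenvectorUnitary : Matrix n n ℝ)ᵀ * Aᵀ

/-- The four Penrose equations, which characterize the Moore–Penrose pseudo-inverse. -/
theorem pinv_penrose {m n : Type*} [Fintype m] [Fintype n] [DecidableEq n] (A : Matrix m n ℝ) :
    A * pinv A * A = A ∧ pinv A * A * pinv A = pinv A ∧
      (A * pinv A)ᵀ = A * pinv A ∧ (pinv A * A)ᵀ = pinv A * A := by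
  have hA : (Aᵀ * A).IsHermitian := isHermitian_conjTranspose_mul_self A
  obtain ⟨W, hW⟩ : ∃ W : Matrix n n ℝ, W = (hA.eigenvectorUnitary : Matrix n n ℝ) := ⟨_, rfl⟩
  obtain ⟨l, hl⟩ : ∃ l : n → ℝ, l = hA.eigenvalues := ⟨_, rfl⟩
  have hWW : Wᵀ * W = 1 := by
    rw [hW]; exact (Unitary.mem_iff.mp hA.eigenvectorUnitary.2).1
  have hG : Aᵀ * A = W * diagonal l * Wᵀ := by
    have h := hA.spectral_theorem
    rw [Unitary.conjStarAlgAut_apply] at h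
    rw [hW, hl]
    exact h
  have hp : pinv A = W * diagonal (fun i => (l i)⁻¹) * Wᵀ * Aᵀ := by
    rw [hW, hl]; rfl
  obtain ⟨Q, hQ⟩ : ∃ Q, Q = W * diagonal (fun i => (l i)⁻¹) * Wᵀ := ⟨_, rfl⟩
  rw [← hQ] at hp
  have hmul : ∀ a b : n → ℝ, (W * diagonal a * Wᵀ) * (W * diagonal b * Wᵀ) =
      W * diagonal (fun i => a i * b i) * Wᵀ := by
    intro a b
    rw [← diagonal_mul_diagonal]
    calc _ = W * diagonal a * (Wᵀ * W) * diagonal b * Wᵀ := by simp only [Matrix.mul_assoc]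
      _ = _ := by rw [hWW]; simp only [Matrix.mul_assoc, Matrix.one_mul]
  have hsym : ∀ a : n → ℝ, (W * diagonal a * Wᵀ)ᵀ = W * diagonal a * Wᵀ := by
    intro a
    simp [Matrix.transpose_mul, Matrix.mul_assoc]
  have hQt : Qᵀ = Q := by rw [hQ]; exact hsym _
  have hQG : Q * (Aᵀ * A) = W * diagonal (fun i => (l i)⁻¹ * l i) * Wᵀ := by
    rw [hQ, hG, hmul]
  have hQGt : (Q * (Aᵀ * A))ᵀ = Q * (Aᵀ * A) := by rw [hQG]; exact hsym _
  have hGQG : (Aᵀ * A) * (Q * (Aᵀ * A)) = Aᵀ * A := by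
    rw [hQG, hG, hmul]
    congr 3
    funext i
    by_cases h : l i = 0 <;> simp [h]
  have hQGQ : Q * (Aᵀ * A) * Q = Q := by
    rw [hQG, hQ, hmul]
    congr 3
    funext i
    by_cases h : l i = 0 <;> simp [h]
  have h1 : A * (Q * (Aᵀ * A)) = A := by
    have hB : (A * (Q * (Aᵀ * A)) - A)ᵀ * (A * (Q * (Aᵀ * A)) - A) = 0 := by
      have : (A * (Q * (Aᵀ * A)) - A)ᵀ * (A * (Q * (Aᵀ * A)) - A) =
          (Q * (Aᵀ * A))ᵀ * ((Aᵀ * A) * (Q * (Aᵀ * A)) - Aᵀ * A) -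
            ((Aᵀ * A) * (Q * (Aᵀ * A)) - Aᵀ * A) := by
        rw [Matrix.transpose_sub, Matrix.transpose_mul A, Matrix.sub_mul, Matrix.mul_sub,
          Matrix.mul_sub, Matrix.mul_sub]
        simp only [Matrix.mul_assoc]
      rw [this, hGQG]; simp
    exact sub_eq_zero.mp (conjTranspose_mul_self_eq_zero.mp hB)
  refine ⟨?_, ?_, ?_, ?_⟩
  · rw [hp]
    simpa only [Matrix.mul_assoc] using h1
  · rw [hp]
    calc Q * Aᵀ * A * (Q * Aᵀ) = (Q * (Aᵀ * A) * Q) * Aᵀ := by simp only [Matrix.mul_assoc]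
      _ = _ := by rw [hQGQ]
  · rw [hp]
    simp [Matrix.transpose_mul, hQt, Matrix.mul_assoc]
  · rw [hp, Matrix.mul_assoc, hQGt]

/-- The sampling matrix of `S ⊆ [d]`, with columns indexed by `S`; `M * sampling S` is `M_{:,S}`. -/
def sampling {d : ℕ} (S : Finset (Fin d)) : Matrix (Fin d) S ℝ :=
  (1 : Matrix (Fin d) (Fin d) ℝ).submatrix id (fun i : S => (i : Fin d))

/-- The sketched least-squares estimator `ŵ_S = S (X S)⁺ y`. -/
def sketchedLS {N d : ℕ} (X : Matrix (Fin N) (Fin d) ℝ) (S : Finset (Fin d))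
    (y : EuclideanSpace ℝ (Fin N)) : EuclideanSpace ℝ (Fin d) :=
  WithLp.toLp 2 (sampling S *ᵥ (pinv (X * sampling S) *ᵥ y.ofLp))

/-- The excess risk `𝔼_ξ [‖X w⋆ - X ŵ(y)‖² / N]` of an estimator `ŵ`, a function of the response
`y = X w⋆ + ξ`. -/
def excessRisk {Ω : Type*} [MeasurableSpace Ω] (Q : Measure Ω) {N d : ℕ}
    (ξ : Fin N → Ω → ℝ) (X : Matrix (Fin N) (Fin d) ℝ) (wstar : EuclideanSpace ℝ (Fin d))
    (est : EuclideanSpace ℝ (Fin N) → EuclideanSpace ℝ (Fin d)) : ℝ :=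
  ∫ ω, ‖X.toEuclideanLin wstar -
    X.toEuclideanLin (est (X.toEuclideanLin wstar + WithLp.toLp 2 (fun i => ξ i ω)))‖ ^ 2 / N ∂Q

end ColumnSubset

end

/-!
Write `G s = V_sᵀ V_s` for the Gram matrix of the rows of `V_k` indexed by `s`. The projection DPP
is volume sampling: `Y` has `k` elements almost surely and `ℙ(Y = s) = det (G s)` for `|s| = k`,
hence `ℙ(Y ⊆ L) = det (G L)` by the Cauchy–Binet formula.

*Bias.* When `G s` is invertible, the minimum-norm vector supported on `s` that has the same image
as `w` under `V_kᵀ` differs from `w` by a vector that `X` stretches by at most `σ_{k+1}`, and whose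
squared norm is at most `(1 + tr (G s)⁻¹) ‖w‖²`. Least squares on the columns in `s` does at least
as well as this competitor. The noise adds `v` times the rank of the fit, at most `v k`.

*Averaging over `Y`.* The product `det (G s) · tr (G s)⁻¹ = tr adj (G s)` is a sum of Gram
determinants with one column fewer. Expanding each by Cauchy–Binet and counting the `k`-subsets of
`L` that contain a given `(k - 1)`-subset gives
`𝔼[tr (G Y)⁻¹ | Y ⊆ L] ≤ (|L| - k + 1) tr (G L)⁻¹`.

*Choice of `L`.* The eigenvalues of `G L` are at most `1`, and their sum is the sum of the leverage
scores over `L`. If it is at least `k - 1 + 1/θ`, then convexity of the inverse gives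
`tr (G L)⁻¹ ≤ k - 1 + θ`; the extreme case is a single eigenvalue `1/θ`, all others being `1`.
-/

noncomputable section

namespace ColumnSubset

section RowGram

variable {ι n R : Type*}

/-- The Gram matrix `A_sᵀ A_s` of the columns of `A_s`, the matrix formed by the rows of `A` that
are indexed by `s`. It is written as a sum of rank-one matrices, so that it depends on `s`
additively. -/
def rowGram [NonUnitalNonAssocSemiring R] (A : Matrix ι n R) (s : Finset ι) : Matrix n n R :=
  ∑ r ∈ s, vecMulVec (A r) (A r)

theorem rowGram_apply [NonUnitalNonAssocSemiring R] (A : Matrix ι n R) (s : Finset ι) (i j : n) :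
    rowGram A s i j = ∑ r ∈ s, A r i * A r j := by
  simp [rowGram, Matrix.sum_apply, vecMulVec_apply]

theorem rowGram_univ [Fintype ι] [NonUnitalNonAssocSemiring R] (A : Matrix ι n R) :
    rowGram A Finset.univ = Aᵀ * A := by
  ext i j
  simp [rowGram_apply, Matrix.mul_apply]

theorem rowGram_eq_transpose_mul [NonUnitalNonAssocSemiring R] (A : Matrix ι n R) (s : Finset ι) :
    rowGram A s = (A.submatrix ((↑) : s → ι) id)ᵀ * A.submatrix ((↑) : s → ι) id := by
  ext i j
  simp [rowGram_apply, Matrix.mul_apply, Finset.sum_attach s fun r => A r i * A r j]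

theorem det_rowGram_eq_sum_injective [CommRing R] [DecidableEq ι] [Fintype n] [DecidableEq n]
    (A : Matrix ι n R) (s : Finset ι) :
    (rowGram A s).det = ∑ f ∈ (Fintype.piFinset fun _ : n => s).filter Function.Injective,
      (∏ i, A (f i) i) * (A.submatrix f id).det := by
  have hrows : rowGram A s = fun i => ∑ r ∈ s, A r i • A r := by
    ext i j
    simp [rowGram_apply]
  have hexpand : (rowGram A s).det =
      ∑ f ∈ Fintype.piFinset fun _ : n => s, (∏ i, A (f i) i) * (A.submatrix f id).det := by
    rw [hrows]
    exact (detRowAlternating.toMultilinearMap.map_sum_finset _ _).trans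
      (Finset.sum_congr rfl fun f _ => detRowAlternating.toMultilinearMap.map_smul_univ _ _)
  rw [hexpand, Finset.sum_filter_of_ne]
  intro f _ hf a b hab
  by_contra hne
  exact hf (by rw [det_zero_of_row_eq hne (by ext; simp [hab]), mul_zero])

theorem det_rowGram_eq_sum_powersetCard [CommRing R] [Fintype n] [DecidableEq n]
    (A : Matrix ι n R) (s : Finset ι) :
    (rowGram A s).det = ∑ t ∈ s.powersetCard (Fintype.card n), (rowGram A t).det := by
  classical
  have himage : ∀ f ∈ (Fintype.piFinset fun _ : n => s).filter Function.Injective,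
      Finset.univ.image f ∈ s.powersetCard (Fintype.card n) := by
    intro f hf
    obtain ⟨hfs, hinj⟩ := Finset.mem_filter.mp hf
    rw [Finset.mem_powersetCard, Finset.card_image_of_injective _ hinj, Finset.card_univ]
    exact ⟨Finset.image_subset_iff.mpr fun i _ => Fintype.mem_piFinset.mp hfs i, rfl⟩
  rw [det_rowGram_eq_sum_injective, ← Finset.sum_fiberwise_of_maps_to himage]
  refine Finset.sum_congr rfl fun t ht => ?_
  obtain ⟨hts, hcard⟩ := Finset.mem_powersetCard.mp ht
  rw [det_rowGram_eq_sum_injective]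
  refine Finset.sum_congr (Finset.ext fun f => ?_) fun _ _ => rfl
  simp only [Finset.mem_filter, Fintype.mem_piFinset]
  constructor
  · rintro ⟨⟨-, hinj⟩, rfl⟩
    exact ⟨fun i => Finset.mem_image_of_mem f (Finset.mem_univ i), hinj⟩
  · rintro ⟨hft, hinj⟩
    refine ⟨⟨fun i => hts (hft i), hinj⟩, Finset.eq_of_subset_of_card_le
      (Finset.image_subset_iff.mpr fun i _ => hft i) ?_⟩
    rw [Finset.card_image_of_injective _ hinj, hcard, Finset.card_univ]

theorem card_le_card_of_det_rowGram_ne_zero [CommRing R] [Fintype n] [DecidableEq n]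
    {A : Matrix ι n R} {s : Finset ι} (h : (rowGram A s).det ≠ 0) :
    Fintype.card n ≤ s.card := by
  rw [det_rowGram_eq_sum_powersetCard] at h
  by_contra! hlt
  exact h (by rw [Finset.powersetCard_eq_empty.mpr hlt, Finset.sum_empty])

end RowGram

section Adjugate

variable {ι R : Type*}

theorem card_filter_superset_powersetCard [DecidableEq ι] {s t : Finset ι} (hts : t ⊆ s) (m : ℕ) :
    ((s.powersetCard (t.card + m)).filter (t ⊆ ·)).card = (s.card - t.card).choose m := by
  rw [← Finset.card_sdiff_of_subset hts, ← Finset.card_powersetCard]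
  refine Finset.card_nbij' (· \ t) (· ∪ t) ?_ ?_ ?_ ?_
  · intro u hu
    simp only [Finset.coe_filter, Finset.mem_powersetCard, Set.mem_ofPred_eq] at hu
    simp only [Finset.mem_coe, Finset.mem_powersetCard]
    exact ⟨Finset.sdiff_subset_sdiff hu.1.1 subset_rfl, by
      rw [Finset.card_sdiff_of_subset hu.2, hu.1.2, Nat.add_sub_cancel_left]⟩
  · intro u hu
    simp only [Finset.mem_coe, Finset.mem_powersetCard, Finset.subset_sdiff] at hu
    simp only [Finset.coe_filter, Finset.mem_powersetCard, Set.mem_ofPred_eq]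
    exact ⟨⟨Finset.union_subset hu.1.1 hts, by
      rw [Finset.card_union_of_disjoint hu.1.2, hu.2, add_comm]⟩, Finset.subset_union_right⟩
  · intro u hu
    exact Finset.sdiff_union_of_subset (Finset.mem_filter.mp hu).2
  · intro u hu
    simp only [Finset.mem_coe, Finset.mem_powersetCard, Finset.subset_sdiff] at hu
    exact Finset.union_sdiff_cancel_right hu.1.2

theorem sum_powersetCard_add_sum_powersetCard {M : Type*} [AddCommMonoid M]
    (s : Finset ι) (k m : ℕ) (f : Finset ι → M) :
    ∑ u ∈ s.powersetCard (k + m), ∑ t ∈ u.powersetCard k, f t =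
      (s.card - k).choose m • ∑ t ∈ s.powersetCard k, f t := by
  classical
  rw [Finset.sum_comm' (t' := s.powersetCard k)
    (s' := fun t => (s.powersetCard (k + m)).filter (t ⊆ ·)), Finset.smul_sum]
  · refine Finset.sum_congr rfl fun t ht => ?_
    obtain ⟨hts, rfl⟩ := Finset.mem_powersetCard.mp ht
    rw [Finset.sum_const, card_filter_superset_powersetCard hts]
  · intro u t
    simp only [Finset.mem_filter, Finset.mem_powersetCard]
    exact ⟨fun ⟨⟨hus, hu⟩, htu, ht⟩ => ⟨⟨⟨hus, hu⟩, htu⟩, htu.trans hus, ht⟩,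
      fun ⟨⟨⟨hus, hu⟩, htu⟩, _, ht⟩ => ⟨⟨hus, hu⟩, htu, ht⟩⟩

theorem trace_adjugate_rowGram [CommRing R] {k : ℕ} (A : Matrix ι (Fin (k + 1)) R)
    (s : Finset ι) : (rowGram A s).adjugate.trace =
      ∑ j : Fin (k + 1), (rowGram (A.submatrix id j.succAbove) s).det := by
  refine Finset.sum_congr rfl fun j _ => ?_
  rw [diag_apply, adjugate_fin_succ_eq_det_submatrix, ← two_mul, pow_mul, neg_one_sq, one_pow,
    one_mul]
  congr 1
  ext
  simp [rowGram_apply]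

theorem sum_trace_adjugate_rowGram [CommRing R] {k : ℕ} (A : Matrix ι (Fin k) R)
    (s : Finset ι) : ∑ t ∈ s.powersetCard k, (rowGram A t).adjugate.trace =
      (s.card + 1 - k) • (rowGram A s).adjugate.trace := by
  cases k with
  | zero => simp [Matrix.trace]
  | succ k =>
    have hminor : ∀ (j : Fin (k + 1)) t, (rowGram (A.submatrix id j.succAbove) t).det =
        ∑ r ∈ t.powersetCard k, (rowGram (A.submatrix id j.succAbove) r).det := fun j t => by
      simpa only [Fintype.card_fin] using
        det_rowGram_eq_sum_powersetCard (A.submatrix id j.succAbove) t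
    simp only [trace_adjugate_rowGram]
    rw [Finset.sum_comm, Finset.smul_sum]
    refine Finset.sum_congr rfl fun j _ => ?_
    rw [hminor j s, Finset.sum_congr rfl fun t _ => hminor j t,
      sum_powersetCard_add_sum_powersetCard, Nat.choose_one_right, Nat.add_sub_add_right]

end Adjugate

section Spectral

variable {n : Type*} [Fintype n]

theorem trace_inv_eq_sum_inv_eigenvalues {𝕜 : Type*} [RCLike 𝕜] [DecidableEq n]
    {G : Matrix n n 𝕜} (hG : G.IsHermitian) (hdet : G.det ≠ 0) :
    G⁻¹.trace = ∑ i, ((hG.eigenvalues i)⁻¹ : 𝕜) := by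
  obtain ⟨hW, hW'⟩ := Unitary.mem_iff.mp hG.eigenvectorUnitary.2
  set W := (hG.eigenvectorUnitary : Matrix n n 𝕜)
  have hspec : G = W * diagonal (fun i => (hG.eigenvalues i : 𝕜)) * star W :=
    hG.spectral_theorem.trans (Unitary.conjStarAlgAut_apply _ _)
  have hne : ∀ i, (hG.eigenvalues i : 𝕜) ≠ 0 := by
    simpa only [hG.det_eq_prod_eigenvalues, Finset.prod_ne_zero_iff, Finset.mem_univ,
      true_imp_iff] using hdet
  have hinv : G⁻¹ = W * diagonal (fun i => (hG.eigenvalues i : 𝕜)⁻¹) * star W := by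
    refine inv_eq_left_inv ((congrArg (_ * ·) hspec).trans ?_)
    calc W * diagonal (fun i => (hG.eigenvalues i : 𝕜)⁻¹) * star W *
          (W * diagonal (fun i => (hG.eigenvalues i : 𝕜)) * star W)
        = W * diagonal (fun i => (hG.eigenvalues i : 𝕜)⁻¹) * (star W * W) *
            diagonal (fun i => (hG.eigenvalues i : 𝕜)) * star W := by
          simp only [Matrix.mul_assoc]
      _ = W * star W := by
          simp only [hW, Matrix.mul_one, Matrix.mul_assoc W, diagonal_mul_diagonal,
            inv_mul_cancel₀ (hne _), diagonal_one]
      _ = 1 := hW'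
  rw [hinv, trace_mul_cycle, hW, Matrix.one_mul, trace_diagonal]

theorem eigenvalues_le_one [DecidableEq n] {G : Matrix n n ℝ} (hG : G.IsHermitian)
    (h : (1 - G).PosSemidef) (i : n) : hG.eigenvalues i ≤ 1 := by
  have hnorm : star (hG.eigenvectorBasis i).ofLp ⬝ᵥ (hG.eigenvectorBasis i).ofLp = 1 := by
    rw [dotProduct_comm, ← EuclideanSpace.inner_eq_star_dotProduct, inner_self_eq_norm_sq_to_K,
      hG.eigenvectorBasis.norm_eq_one, RCLike.ofReal_one, one_pow]
  have hquad := h.dotProduct_mulVec_nonneg (hG.eigenvectorBasis i).ofLp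
  rw [sub_mulVec, one_mulVec, dotProduct_sub, hnorm, sub_nonneg] at hquad
  exact (hG.eigenvalues_eq i).trans_le hquad

theorem pos_and_sum_inv_le_of_sum_ge {l : n → ℝ} {θ : ℝ} (hθ : 0 < θ) (hl : ∀ i, l i ≤ 1)
    (hsum : (Fintype.card n : ℝ) - 1 + 1 / θ ≤ ∑ i, l i) :
    (∀ i, 0 < l i) ∧ ∑ i, (l i)⁻¹ ≤ (Fintype.card n : ℝ) - 1 + θ := by
  have hdefect : ∑ i, (1 - l i) ≤ 1 - 1 / θ := by
    simp only [Finset.sum_sub_distrib, Finset.sum_const, Finset.card_univ, nsmul_eq_mul, mul_one]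
    linarith
  have hlow : ∀ i, 1 / θ ≤ l i := fun i => by
    have := Finset.single_le_sum (f := fun i => 1 - l i) (fun j _ => sub_nonneg.mpr (hl j))
      (Finset.mem_univ i)
    linarith
  have hpos : ∀ i, 0 < l i := fun i => (one_div_pos.mpr hθ).trans_le (hlow i)
  -- The chord of the convex function `x ↦ x⁻¹` over `[1/θ, 1]` lies above its graph.
  have hchord : ∀ i, (l i)⁻¹ ≤ 1 + θ * (1 - l i) := fun i => by
    have h : 1 ≤ θ * l i := (div_le_iff₀' hθ).mp (hlow i)
    rw [inv_le_iff_one_le_mul₀ (hpos i)]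
    nlinarith [mul_nonneg (sub_nonneg.mpr h) (sub_nonneg.mpr (hl i))]
  refine ⟨hpos, ?_⟩
  calc ∑ i, (l i)⁻¹ ≤ ∑ i, (1 + θ * (1 - l i)) := Finset.sum_le_sum fun i _ => hchord i
    _ = Fintype.card n + θ * ∑ i, (1 - l i) := by simp [Finset.sum_add_distrib, ← Finset.mul_sum]
    _ ≤ Fintype.card n + θ * (1 - 1 / θ) := by gcongr
    _ = Fintype.card n - 1 + θ := by field_simp; ring

theorem det_pos_and_trace_inv_le_of_trace_ge [DecidableEq n] {G : Matrix n n ℝ} {θ : ℝ} (hθ : 0 < θ)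
    (hG : G.IsHermitian) (hG1 : (1 - G).PosSemidef)
    (htrace : (Fintype.card n : ℝ) - 1 + 1 / θ ≤ G.trace) :
    0 < G.det ∧ G⁻¹.trace ≤ (Fintype.card n : ℝ) - 1 + θ := by
  rw [hG.trace_eq_sum_eigenvalues] at htrace
  obtain ⟨hpos, hinv⟩ := pos_and_sum_inv_le_of_sum_ge hθ (eigenvalues_le_one hG hG1) htrace
  have hdet : 0 < G.det := by
    rw [hG.det_eq_prod_eigenvalues]
    exact Finset.prod_pos fun i _ => hpos i
  exact ⟨hdet, (trace_inv_eq_sum_inv_eigenvalues hG hdet.ne').trans_le hinv⟩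

end Spectral

section RealGram

variable {ι n : Type*}

theorem posSemidef_rowGram [Finite n] (A : Matrix ι n ℝ) (s : Finset ι) :
    (rowGram A s).PosSemidef := by
  rw [rowGram_eq_transpose_mul]
  exact posSemidef_conjTranspose_mul_self _

theorem one_sub_rowGram [Fintype ι] [DecidableEq ι] [DecidableEq n] {V : Matrix ι n ℝ}
    (hV : Vᵀ * V = 1) (s : Finset ι) : 1 - rowGram V s = rowGram V sᶜ := by
  rw [← hV, ← rowGram_univ, rowGram, rowGram, rowGram, ← Finset.sum_compl_add_sum s,
    add_sub_cancel_right]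

theorem det_mul_trace_inv {K : Type*} [Field K] [Fintype n] [DecidableEq n] {G : Matrix n n K}
    (hG : G.det ≠ 0) : G.det * G⁻¹.trace = G.adjugate.trace := by
  rw [inv_def, trace_smul, Ring.inverse_eq_inv', smul_eq_mul, mul_inv_cancel_left₀ hG]

theorem trace_adjugate_rowGram_nonneg {k : ℕ} (A : Matrix ι (Fin k) ℝ) (s : Finset ι) :
    0 ≤ (rowGram A s).adjugate.trace := by
  cases k with
  | zero => simp [Matrix.trace]
  | succ k =>
    rw [trace_adjugate_rowGram]
    exact Finset.sum_nonneg fun j _ => (posSemidef_rowGram _ s).det_nonneg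

theorem det_mul_trace_inv_rowGram_le {k : ℕ} (A : Matrix ι (Fin k) ℝ) (s : Finset ι) :
    (rowGram A s).det * (rowGram A s)⁻¹.trace ≤ (rowGram A s).adjugate.trace := by
  by_cases hdet : (rowGram A s).det = 0
  · simpa only [hdet, zero_mul] using trace_adjugate_rowGram_nonneg A s
  · exact (det_mul_trace_inv hdet).le

theorem sum_det_mul_trace_inv_rowGram_le {k : ℕ} {A : Matrix ι (Fin k) ℝ} {s : Finset ι}
    (hs : (rowGram A s).det ≠ 0) :
    ∑ t ∈ s.powersetCard k, (rowGram A t).det * (rowGram A t)⁻¹.trace ≤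
      ((s.card : ℝ) - k + 1) * ((rowGram A s).det * (rowGram A s)⁻¹.trace) := by
  have hk : k ≤ s.card := by simpa using card_le_card_of_det_rowGram_ne_zero hs
  calc _ ≤ ∑ t ∈ s.powersetCard k, (rowGram A t).adjugate.trace :=
        Finset.sum_le_sum fun t _ => det_mul_trace_inv_rowGram_le A t
    _ = _ := by
        rw [sum_trace_adjugate_rowGram, det_mul_trace_inv hs, nsmul_eq_mul, Nat.cast_sub (by lia)]
        push_cast
        ring

theorem trace_rowGram {d k : ℕ} (V : Matrix (Fin d) (Fin k) ℝ) (s : Finset (Fin d)) :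
    (rowGram V s).trace = ∑ j ∈ s, leverage V j := by
  simp [rowGram, trace_sum, trace_vecMulVec, leverage, dotProduct, sq]

theorem det_rowGram_pos_and_trace_inv_le {d k : ℕ} {V : Matrix (Fin d) (Fin k) ℝ}
    (hV : Vᵀ * V = 1) {θ : ℝ} (hθ : 0 < θ) {s : Finset (Fin d)}
    (hs : (k : ℝ) - 1 + 1 / θ ≤ ∑ j ∈ s, leverage V j) :
    0 < (rowGram V s).det ∧ (rowGram V s)⁻¹.trace ≤ (k : ℝ) - 1 + θ := by
  have hcompl : (1 - rowGram V s).PosSemidef := by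
    rw [one_sub_rowGram hV]
    exact posSemidef_rowGram V sᶜ
  simpa only [Fintype.card_fin] using det_pos_and_trace_inv_le_of_trace_ge hθ
    (posSemidef_rowGram V s).isHermitian hcompl (by rwa [Fintype.card_fin, trace_rowGram])

theorem sum_leverage {d k : ℕ} {V : Matrix (Fin d) (Fin k) ℝ} (hV : Vᵀ * V = 1) :
    ∑ j, leverage V j = k := by
  rw [← trace_rowGram, rowGram_univ, hV, trace_one, Fintype.card_fin]

end RealGram

section StarProjection

variable {m n : Type*} [Fintype m] [Fintype n]

theorem mulVec_dotProduct_mulVec {R : Type*} [CommSemiring R] (A : Matrix m n R) (x y : n → R) :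
    (A *ᵥ x) ⬝ᵥ (A *ᵥ y) = x ⬝ᵥ ((Aᵀ * A) *ᵥ y) := by
  rw [← mulVec_mulVec, dotProduct_mulVec x, vecMul_transpose]

theorem isStarProjection_mul_transpose [DecidableEq n] {V : Matrix m n ℝ} (hV : Vᵀ * V = 1) :
    IsStarProjection (V * Vᵀ) where
  isIdempotentElem := by
    rw [IsIdempotentElem, Matrix.mul_assoc, ← Matrix.mul_assoc Vᵀ, hV, Matrix.one_mul]
  isSelfAdjoint := isHermitian_mul_conjTranspose_self V

/-- The hat matrix `A A⁺` of least squares with design matrix `A`, that is, the orthogonal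
projection onto the column space of `A`. -/
def hatMatrix [DecidableEq n] (A : Matrix m n ℝ) : Matrix m m ℝ :=
  A * pinv A

theorem isStarProjection_hatMatrix [DecidableEq n] (A : Matrix m n ℝ) :
    IsStarProjection (hatMatrix A) := by
  obtain ⟨hApA, -, hsymm, -⟩ := pinv_penrose A
  exact ⟨by rw [IsIdempotentElem, hatMatrix, ← Matrix.mul_assoc, hApA], hsymm⟩

theorem isStarProjection_pinv_mul [DecidableEq n] (A : Matrix m n ℝ) :
    IsStarProjection (pinv A * A) := by
  obtain ⟨-, hpAp, -, hsymm⟩ := pinv_penrose A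
  exact ⟨by rw [IsIdempotentElem, ← Matrix.mul_assoc, hpAp], hsymm⟩

theorem residual_dotProduct_self {R : Matrix n n ℝ} (hR : IsStarProjection R) (x : n → ℝ) :
    (x - R *ᵥ x) ⬝ᵥ (x - R *ᵥ x) = x ⬝ᵥ x - (R *ᵥ x) ⬝ᵥ (R *ᵥ x) := by
  have hsymm : Rᵀ = R := hR.isSelfAdjoint
  have hRx : (R *ᵥ x) ⬝ᵥ (R *ᵥ x) = x ⬝ᵥ (R *ᵥ x) := by
    rw [mulVec_dotProduct_mulVec, hsymm, hR.isIdempotentElem.eq]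
  rw [sub_dotProduct, dotProduct_sub, dotProduct_sub, dotProduct_comm (R *ᵥ x) x, hRx]
  ring

theorem residual_dotProduct_self_le {R : Matrix n n ℝ} (hR : IsStarProjection R) (x : n → ℝ) :
    (x - R *ᵥ x) ⬝ᵥ (x - R *ᵥ x) ≤ x ⬝ᵥ x := by
  rw [residual_dotProduct_self hR]
  exact sub_le_self _ (dotProduct_self_star_nonneg (R *ᵥ x))

theorem trace_le_card {R : Matrix n n ℝ} (hR : IsStarProjection R) :
    R.trace ≤ Fintype.card n := by
  classical
  have hcompl : (1 - R).PosSemidef := by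
    rw [← hR.one_sub.isIdempotentElem.eq]
    nth_rewrite 1 [← hR.one_sub.isSelfAdjoint.star_eq]
    exact posSemidef_conjTranspose_mul_self (1 - R)
  simpa [trace_sub, trace_one] using hcompl.trace_nonneg

theorem trace_hatMatrix_le [DecidableEq n] (A : Matrix m n ℝ) :
    (hatMatrix A).trace ≤ Fintype.card n := by
  rw [hatMatrix, trace_mul_comm]
  exact trace_le_card (isStarProjection_pinv_mul A)

theorem residual_hatMatrix_le [DecidableEq n] (A : Matrix m n ℝ) (z : m → ℝ) (c : n → ℝ) :
    (z - hatMatrix A *ᵥ z) ⬝ᵥ (z - hatMatrix A *ᵥ z) ≤ (z - A *ᵥ c) ⬝ᵥ (z - A *ᵥ c) := by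
  have hshift : z - hatMatrix A *ᵥ z = (z - A *ᵥ c) - hatMatrix A *ᵥ (z - A *ᵥ c) := by
    rw [hatMatrix, mulVec_sub, mulVec_mulVec, (pinv_penrose A).1, sub_sub_sub_cancel_right]
  rw [hshift]
  exact residual_dotProduct_self_le (isStarProjection_hatMatrix A) _

theorem transpose_mulVec_dotProduct_self [DecidableEq n] {V : Matrix m n ℝ} (hV : Vᵀ * V = 1)
    (u : m → ℝ) : (Vᵀ *ᵥ u) ⬝ᵥ (Vᵀ *ᵥ u) = ((V * Vᵀ) *ᵥ u) ⬝ᵥ ((V * Vᵀ) *ᵥ u) := by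
  rw [← mulVec_mulVec, mulVec_dotProduct_mulVec V, hV, one_mulVec]

theorem transpose_mulVec_dotProduct_self_le [DecidableEq n] {V : Matrix m n ℝ}
    (hV : Vᵀ * V = 1) (u : m → ℝ) : (Vᵀ *ᵥ u) ⬝ᵥ (Vᵀ *ᵥ u) ≤ u ⬝ᵥ u := by
  rw [transpose_mulVec_dotProduct_self hV, ← sub_nonneg,
    ← residual_dotProduct_self (isStarProjection_mul_transpose hV)]
  exact dotProduct_self_star_nonneg _

end StarProjection

section Comparison

variable {m n : Type*} [Fintype m] [Fintype n]

theorem sub_dotProduct_self_le {a q : n → ℝ} {t β : ℝ} (ht : 0 ≤ t) (hβ : 0 ≤ β)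
    (hq : q ⬝ᵥ q ≤ t * β) : (a - q) ⬝ᵥ (a - q) ≤ (1 + t) * (a ⬝ᵥ a + β) := by
  rcases ht.eq_or_lt with rfl | ht
  · have hq0 : q = 0 := dotProduct_self_star_eq_zero.mp
      (le_antisymm (by simpa using hq) (dotProduct_self_star_nonneg q))
    simpa [hq0] using hβ
  · have hcross : -(2 * (a ⬝ᵥ q)) ≤ t * (a ⬝ᵥ a) + β := by
      have h : 0 ≤ (t • a + q) ⬝ᵥ (t • a + q) := dotProduct_self_star_nonneg _
      simp only [add_dotProduct, dotProduct_add, smul_dotProduct, dotProduct_smul, smul_eq_mul,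
        dotProduct_comm q a] at h
      refine le_of_mul_le_mul_left ?_ ht
      linarith
    rw [sub_dotProduct, dotProduct_sub, dotProduct_sub, dotProduct_comm q a]
    linarith

theorem sub_dotProduct_self_le_of_mulVec_eq {R : Matrix n n ℝ} (hR : IsStarProjection R)
    {x y : n → ℝ} (hxy : R *ᵥ x = R *ᵥ y) {t : ℝ} (ht : 0 ≤ t)
    (hy : y ⬝ᵥ y ≤ t * ((R *ᵥ x) ⬝ᵥ (R *ᵥ x))) :
    (x - y) ⬝ᵥ (x - y) ≤ (1 + t) * (x ⬝ᵥ x) := by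
  have hsplit : x - y = (x - R *ᵥ x) - (y - R *ᵥ y) := by rw [hxy, sub_sub_sub_cancel_right]
  have hpyth := residual_dotProduct_self hR x
  rw [hsplit, ← sub_add_cancel (x ⬝ᵥ x) ((R *ᵥ x) ⬝ᵥ (R *ᵥ x)), ← hpyth]
  exact sub_dotProduct_self_le ht (dotProduct_self_star_nonneg (R *ᵥ x))
    ((residual_dotProduct_self_le hR y).trans hy)

theorem mulVec_dotProduct_self_le_trace (F : Matrix m n ℝ) (b : n → ℝ) :
    (F *ᵥ b) ⬝ᵥ (F *ᵥ b) ≤ (Fᵀ * F).trace * (b ⬝ᵥ b) := by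
  have hfrobenius : (Fᵀ * F).trace = ∑ i, ∑ j, F i j ^ 2 := by
    simp only [Matrix.trace, diag_apply, Matrix.mul_apply, transpose_apply, ← sq]
    exact Finset.sum_comm
  rw [hfrobenius, Finset.sum_mul]
  refine Finset.sum_le_sum fun i _ => ?_
  simpa only [mulVec, dotProduct, ← sq] using
    Finset.sum_mul_sq_le_sq_mul_sq Finset.univ (F i) b

theorem exists_transpose_mulVec_eq [DecidableEq n] {B : Matrix m n ℝ} (hB : (Bᵀ * B).det ≠ 0)
    (b : n → ℝ) : ∃ c : m → ℝ, Bᵀ *ᵥ c = b ∧ c ⬝ᵥ c ≤ (Bᵀ * B)⁻¹.trace * (b ⬝ᵥ b) := by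
  have hunit : IsUnit (Bᵀ * B).det := isUnit_iff_ne_zero.mpr hB
  have hBF : Bᵀ * (B * (Bᵀ * B)⁻¹) = 1 := by rw [← Matrix.mul_assoc, mul_nonsing_inv _ hunit]
  have hFF : (B * (Bᵀ * B)⁻¹)ᵀ * (B * (Bᵀ * B)⁻¹) = (Bᵀ * B)⁻¹ := by
    rw [transpose_mul, Matrix.mul_assoc, hBF, Matrix.mul_one, transpose_nonsing_inv,
      transpose_mul, transpose_transpose]
  refine ⟨(B * (Bᵀ * B)⁻¹) *ᵥ b, by rw [mulVec_mulVec, hBF, one_mulVec], ?_⟩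
  simpa only [hFF] using mulVec_dotProduct_self_le_trace (B * (Bᵀ * B)⁻¹) b

end Comparison

section Bias

variable {N d n m k : ℕ}

theorem sampling_transpose_mul_self (s : Finset (Fin d)) : (sampling s)ᵀ * sampling s = 1 := by
  calc (sampling s)ᵀ * sampling s
      = ((1 : Matrix (Fin d) (Fin d) ℝ)ᵀ * 1).submatrix ((↑) : s → Fin d) (↑) := rfl
    _ = 1 := by rw [transpose_one, Matrix.mul_one, submatrix_one _ Subtype.val_injective]

theorem transpose_mul_sampling (V : Matrix (Fin d) (Fin k) ℝ) (s : Finset (Fin d)) :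
    Vᵀ * sampling s = (V.submatrix ((↑) : s → Fin d) id)ᵀ := by
  ext i j
  simp [sampling, Matrix.mul_apply, Matrix.one_apply]

theorem exists_sampling_approx {V : Matrix (Fin d) (Fin k) ℝ} (hV : Vᵀ * V = 1)
    {s : Finset (Fin d)} (hs : (rowGram V s).det ≠ 0) (w : Fin d → ℝ) :
    ∃ c : s → ℝ, Vᵀ *ᵥ (w - sampling s *ᵥ c) = 0 ∧
      (w - sampling s *ᵥ c) ⬝ᵥ (w - sampling s *ᵥ c) ≤
        (1 + (rowGram V s)⁻¹.trace) * (w ⬝ᵥ w) := by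
  have htrace : 0 ≤ (rowGram V s)⁻¹.trace := (posSemidef_rowGram V s).inv.trace_nonneg
  rw [rowGram_eq_transpose_mul] at hs htrace ⊢
  obtain ⟨c, hc, hnorm⟩ := exists_transpose_mulVec_eq hs (Vᵀ *ᵥ w)
  have hVc : Vᵀ *ᵥ (sampling s *ᵥ c) = Vᵀ *ᵥ w := by
    rw [mulVec_mulVec, transpose_mul_sampling, hc]
  refine ⟨c, by rw [mulVec_sub, hVc, sub_self],
    sub_dotProduct_self_le_of_mulVec_eq (isStarProjection_mul_transpose hV) ?_ htrace ?_⟩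
  · rw [← mulVec_mulVec, ← mulVec_mulVec, hVc]
  · rwa [mulVec_dotProduct_mulVec (sampling s), sampling_transpose_mul_self, one_mulVec,
      ← transpose_mulVec_dotProduct_self hV]

theorem rectDiagonal_transpose_mul_self {σ : ℕ → ℝ} (hσ : ∀ j : Fin m, n ≤ j → σ j = 0) :
    (rectDiagonal n m σ)ᵀ * rectDiagonal n m σ = diagonal fun j : Fin m => σ j ^ 2 := by
  ext i j
  simp only [Matrix.mul_apply, transpose_apply, rectDiagonal, Matrix.of_apply, ite_mul, zero_mul,
    diagonal_apply]
  by_cases hin : (i : ℕ) < n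
  · rw [Finset.sum_eq_single ⟨i, hin⟩]
    · simp [Fin.ext_iff, sq]
    · exact fun r _ hr => if_neg fun h => hr (Fin.ext h)
    · simp
  · rw [hσ i (not_lt.mp hin), zero_pow two_ne_zero, ite_self]
    exact Finset.sum_eq_zero fun r _ => if_neg fun h : (r : ℕ) = i => hin (h ▸ r.2)

theorem firstCols_transpose_mul_self {V : Matrix (Fin d) (Fin m) ℝ} (hV : Vᵀ * V = 1)
    (hkm : k ≤ m) : (firstCols V hkm)ᵀ * firstCols V hkm = 1 := by
  calc (firstCols V hkm)ᵀ * firstCols V hkm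
      = (Vᵀ * V).submatrix (Fin.castLE hkm) (Fin.castLE hkm) := rfl
    _ = 1 := by rw [hV, submatrix_one _ (Fin.castLE_injective hkm)]

namespace IsSVD

variable {X : Matrix (Fin N) (Fin d) ℝ} {U : Matrix (Fin N) (Fin n) ℝ} {σ : ℕ → ℝ}
  {V : Matrix (Fin d) (Fin m) ℝ}

theorem transpose_mul_self (hX : IsSVD X U σ V) :
    Xᵀ * X = V * diagonal (fun j : Fin m => σ j ^ 2) * Vᵀ := by
  have hσ : ∀ j : Fin m, n ≤ j → σ j = 0 := fun j hj => hX.eq_zero j (min_le_of_left_le hj)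
  calc Xᵀ * X
      = V * ((rectDiagonal n m σ)ᵀ * (Uᵀ * U) * rectDiagonal n m σ) * Vᵀ := by
        simp only [hX.decomposition, transpose_mul, transpose_transpose, Matrix.mul_assoc]
    _ = _ := by
        rw [hX.orthonormal_left, Matrix.mul_one, rectDiagonal_transpose_mul_self hσ]

theorem mulVec_dotProduct_self_le (hX : IsSVD X U σ V) (hkm : k ≤ m) {u : Fin d → ℝ}
    (hu : (firstCols V hkm)ᵀ *ᵥ u = 0) : (X *ᵥ u) ⬝ᵥ (X *ᵥ u) ≤ σ k ^ 2 * (u ⬝ᵥ u) := by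
  have hcoord : ∀ j : Fin m, σ j ^ 2 * (Vᵀ *ᵥ u) j ^ 2 ≤ σ k ^ 2 * (Vᵀ *ᵥ u) j ^ 2 := by
    intro j
    rcases lt_or_ge (j : ℕ) k with hj | hj
    · have hz : (Vᵀ *ᵥ u) j = 0 := congrFun hu ⟨j, hj⟩
      simp [hz]
    · have := pow_le_pow_left₀ (hX.nonneg j) (hX.antitone hj) 2
      gcongr
  calc (X *ᵥ u) ⬝ᵥ (X *ᵥ u)
      = (Vᵀ *ᵥ u) ⬝ᵥ (diagonal (fun j : Fin m => σ j ^ 2) *ᵥ (Vᵀ *ᵥ u)) := by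
        rw [mulVec_dotProduct_mulVec, hX.transpose_mul_self, ← mulVec_mulVec, ← mulVec_mulVec,
          dotProduct_mulVec, ← mulVec_transpose]
    _ = ∑ j : Fin m, σ j ^ 2 * (Vᵀ *ᵥ u) j ^ 2 := by
        simp only [dotProduct, mulVec_diagonal, sq, mul_left_comm]
    _ ≤ ∑ j : Fin m, σ k ^ 2 * (Vᵀ *ᵥ u) j ^ 2 := Finset.sum_le_sum fun j _ => hcoord j
    _ = σ k ^ 2 * ((Vᵀ *ᵥ u) ⬝ᵥ (Vᵀ *ᵥ u)) := by simp only [← Finset.mul_sum, dotProduct, sq]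
    _ ≤ σ k ^ 2 * (u ⬝ᵥ u) := by
        gcongr
        exact transpose_mulVec_dotProduct_self_le hX.orthonormal_right u

theorem residual_hatMatrix_le (hX : IsSVD X U σ V) (hkm : k ≤ m) {s : Finset (Fin d)}
    (hs : (rowGram (firstCols V hkm) s).det ≠ 0) (w : Fin d → ℝ) :
    (X *ᵥ w - hatMatrix (X * sampling s) *ᵥ (X *ᵥ w)) ⬝ᵥ
        (X *ᵥ w - hatMatrix (X * sampling s) *ᵥ (X *ᵥ w)) ≤
      σ k ^ 2 * ((1 + (rowGram (firstCols V hkm) s)⁻¹.trace) * (w ⬝ᵥ w)) := by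
  obtain ⟨c, hc, hnorm⟩ :=
    exists_sampling_approx (firstCols_transpose_mul_self hX.orthonormal_right hkm) hs w
  calc _ ≤ (X *ᵥ w - (X * sampling s) *ᵥ c) ⬝ᵥ (X *ᵥ w - (X * sampling s) *ᵥ c) :=
        ColumnSubset.residual_hatMatrix_le _ _ c
    _ = (X *ᵥ (w - sampling s *ᵥ c)) ⬝ᵥ (X *ᵥ (w - sampling s *ᵥ c)) := by
        rw [mulVec_sub, mulVec_mulVec]
    _ ≤ σ k ^ 2 * ((w - sampling s *ᵥ c) ⬝ᵥ (w - sampling s *ᵥ c)) :=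
        hX.mulVec_dotProduct_self_le hkm hc
    _ ≤ _ := by gcongr

end IsSVD

end Bias

section Noise

variable {Ω ι : Type*} [MeasurableSpace Ω] {Q : Measure Ω} {ξ : ι → Ω → ℝ} {v : ℝ}

/-- `ξ` is white noise of level `v`: its entries are centred, of variance `v` and pairwise
uncorrelated. This is all that the excess risk of a linear estimator sees of the noise. -/
structure IsWhiteNoise (Q : Measure Ω) (ξ : ι → Ω → ℝ) (v : ℝ) : Prop where
  memLp : ∀ i, MemLp (ξ i) 2 Q
  integral_eq_zero : ∀ i, ∫ ω, ξ i ω ∂Q = 0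
  variance_eq : ∀ i, variance (ξ i) Q = v
  uncorrelated : Pairwise fun i j => cov[ξ i, ξ j; Q] = 0

namespace IsWhiteNoise

theorem nonneg [Nonempty ι] (hξ : IsWhiteNoise Q ξ v) : 0 ≤ v :=
  (variance_nonneg _ _).trans_eq (hξ.variance_eq (Classical.arbitrary ι))

theorem memLp_sum [Fintype ι] (hξ : IsWhiteNoise Q ξ v) (c : ι → ℝ) :
    MemLp (fun ω => ∑ j, c j * ξ j ω) 2 Q :=
  memLp_finsetSum _ fun j _ => (hξ.memLp j).const_mul _

theorem of_iIndepFun (hindep : iIndepFun ξ Q) (hmemLp : ∀ i, MemLp (ξ i) 2 Q)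
    (hmean : ∀ i, ∫ ω, ξ i ω ∂Q = 0) (hvar : ∀ i, variance (ξ i) Q = v) :
    IsWhiteNoise Q ξ v where
  memLp := hmemLp
  integral_eq_zero := hmean
  variance_eq := hvar
  uncorrelated i j hij := (hindep.indepFun hij).covariance_eq_zero (hmemLp i) (hmemLp j)

variable [IsProbabilityMeasure Q] [Fintype ι]

theorem integral_sum (hξ : IsWhiteNoise Q ξ v) (c : ι → ℝ) :
    ∫ ω, ∑ j, c j * ξ j ω ∂Q = 0 := by
  rw [integral_finsetSum _ fun j _ => ((hξ.memLp j).const_mul _).integrable one_le_two]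
  simp only [integral_const_mul, hξ.integral_eq_zero, mul_zero, Finset.sum_const_zero]

theorem variance_sum (hξ : IsWhiteNoise Q ξ v) (c : ι → ℝ) :
    variance (fun ω => ∑ j, c j * ξ j ω) Q = v * (c ⬝ᵥ c) := by
  rw [← covariance_self (hξ.memLp_sum c).aemeasurable,
    covariance_fun_sum_fun_sum (fun j => (hξ.memLp j).const_mul _)
      fun j => (hξ.memLp j).const_mul _, dotProduct, Finset.mul_sum]
  refine Finset.sum_congr rfl fun i _ => ?_
  rw [Finset.sum_eq_single_of_mem i (Finset.mem_univ i)]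
  · rw [covariance_const_mul_left, covariance_const_mul_right,
      covariance_self (hξ.memLp i).aemeasurable, hξ.variance_eq]
    ring
  · intro j _ hij
    rw [covariance_const_mul_left, covariance_const_mul_right, hξ.uncorrelated hij.symm, mul_zero,
      mul_zero]

theorem integral_sub_sum_sq (hξ : IsWhiteNoise Q ξ v) (a : ℝ) (c : ι → ℝ) :
    ∫ ω, (a - ∑ j, c j * ξ j ω) ^ 2 ∂Q = a ^ 2 + v * (c ⬝ᵥ c) := by
  have hL2 := hξ.memLp_sum c
  have hmean : ∫ ω, (a - ∑ j, c j * ξ j ω) ∂Q = a := by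
    rw [integral_sub (integrable_const a) (hL2.integrable one_le_two), hξ.integral_sum]
    simp
  have hvar := variance_eq_sub ((memLp_const a).sub hL2)
  simp only [Pi.sub_def, Pi.pow_apply, hmean] at hvar
  rw [variance_const_sub hL2.aestronglyMeasurable, hξ.variance_sum] at hvar
  linarith

theorem integral_dotProduct_self_sub_mulVec {m : Type*} [Fintype m] (hξ : IsWhiteNoise Q ξ v)
    (a : m → ℝ) (R : Matrix m ι ℝ) :
    ∫ ω, (a - R *ᵥ fun j => ξ j ω) ⬝ᵥ (a - R *ᵥ fun j => ξ j ω) ∂Q =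
      a ⬝ᵥ a + v * (R * Rᵀ).trace := by
  have hint : ∀ i, Integrable (fun ω => (a i - ∑ j, R i j * ξ j ω) ^ 2) Q := fun i =>
    ((memLp_const (a i)).sub (hξ.memLp_sum (R i))).integrable_sq
  simp only [dotProduct, Pi.sub_apply, mulVec, ← sq]
  rw [integral_finsetSum _ fun i _ => hint i]
  simp only [hξ.integral_sub_sum_sq, Finset.sum_add_distrib, ← Finset.mul_sum]
  rfl

end IsWhiteNoise

section ExcessRisk

variable {N d n m k : ℕ} {ξ : Fin N → Ω → ℝ} [IsProbabilityMeasure Q]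

theorem excessRisk_sketchedLS (hξ : IsWhiteNoise Q ξ v) (X : Matrix (Fin N) (Fin d) ℝ)
    (w : EuclideanSpace ℝ (Fin d)) (s : Finset (Fin d)) :
    excessRisk Q ξ X w (sketchedLS X s) =
      ((X *ᵥ w.ofLp - hatMatrix (X * sampling s) *ᵥ (X *ᵥ w.ofLp)) ⬝ᵥ
          (X *ᵥ w.ofLp - hatMatrix (X * sampling s) *ᵥ (X *ᵥ w.ofLp)) +
        v * (hatMatrix (X * sampling s)).trace) / N := by
  have hproj := isStarProjection_hatMatrix (X * sampling s)
  have hsq : hatMatrix (X * sampling s) * (hatMatrix (X * sampling s))ᵀ =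
      hatMatrix (X * sampling s) := by
    nth_rewrite 2 [← hproj.isSelfAdjoint.star_eq]
    exact hproj.isIdempotentElem.eq
  have hfit : ∀ y : Fin N → ℝ, X *ᵥ (sampling s *ᵥ (pinv (X * sampling s) *ᵥ y)) =
      hatMatrix (X * sampling s) *ᵥ y := fun y => by rw [mulVec_mulVec, mulVec_mulVec, hatMatrix]
  nth_rewrite 3 [← hsq]
  rw [← hξ.integral_dotProduct_self_sub_mulVec, ← integral_div, excessRisk]
  refine integral_congr_ae (.of_forall fun ω => ?_)
  simp only [sub_sub, ← mulVec_add, ← hfit]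
  simp only [sketchedLS, EuclideanSpace.real_norm_sq_eq, dotProduct, ← sq]
  rfl

theorem IsSVD.excessRisk_sketchedLS_le {X : Matrix (Fin N) (Fin d) ℝ} {U : Matrix (Fin N) (Fin n) ℝ}
    {σ : ℕ → ℝ} {V : Matrix (Fin d) (Fin m) ℝ} (hX : IsSVD X U σ V) (hkm : k ≤ m)
    (hξ : IsWhiteNoise Q ξ v) (hv : 0 ≤ v) (w : EuclideanSpace ℝ (Fin d)) {s : Finset (Fin d)}
    (hcard : s.card = k) (hs : (rowGram (firstCols V hkm) s).det ≠ 0) :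
    excessRisk Q ξ X w (sketchedLS X s) ≤
      ‖w‖ ^ 2 * σ k ^ 2 / N * (1 + (rowGram (firstCols V hkm) s)⁻¹.trace) + v * k / N := by
  have hbias := hX.residual_hatMatrix_le hkm hs w.ofLp
  have hnorm : w.ofLp ⬝ᵥ w.ofLp = ‖w‖ ^ 2 := by
    rw [EuclideanSpace.real_norm_sq_eq]
    simp only [dotProduct, sq]
  have hrank : (hatMatrix (X * sampling s)).trace ≤ k := by
    simpa only [Fintype.card_coe, hcard] using trace_hatMatrix_le (X * sampling s)
  rw [hnorm] at hbias
  calc _ ≤ (σ k ^ 2 * ((1 + (rowGram (firstCols V hkm) s)⁻¹.trace) * ‖w‖ ^ 2) + v * k) / N := by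
        rw [excessRisk_sketchedLS hξ]
        gcongr
    _ = _ := by ring

end ExcessRisk

end Noise

section DeterminantalPointProcess

variable {Ω : Type*} [MeasurableSpace Ω] {P : Measure Ω} {d k : ℕ}

theorem det_submatrix_mul_transpose {V : Matrix (Fin d) (Fin k) ℝ} {s : Finset (Fin d)}
    (hs : s.card = k) :
    ((V * Vᵀ).submatrix ((↑) : s → Fin d) ((↑) : s → Fin d)).det = (rowGram V s).det := by
  let e : Fin k ≃ s := (s.equivFinOfCardEq hs).symm
  let B : Matrix s (Fin k) ℝ := V.submatrix ((↑) : s → Fin d) id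
  calc ((V * Vᵀ).submatrix ((↑) : s → Fin d) ((↑) : s → Fin d)).det
      = ((B * Bᵀ).submatrix e e).det := (det_submatrix_equiv_self e _).symm
    _ = (B.submatrix e id * (Bᵀ).submatrix id e).det := rfl
    _ = ((Bᵀ).submatrix id e * B.submatrix e id).det := det_mul_comm _ _
    _ = (rowGram V s).det := by
        rw [submatrix_mul_equiv, submatrix_id_id, rowGram_eq_transpose_mul]

namespace IsDPP

section Kernel

variable {K : Matrix (Fin d) (Fin d) ℝ} {Y : Ω → Finset (Fin d)}

theorem measurableSet_setOf (hY : IsDPP P K Y) (p : Finset (Fin d) → Prop) :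
    MeasurableSet {ω | p (Y ω)} :=
  hY.measurable (Set.toFinite {s | p s}).measurableSet

theorem integrable_comp (hY : IsDPP P K Y) (μ : Measure Ω) [IsFiniteMeasure μ]
    (g : Finset (Fin d) → ℝ) : Integrable (fun ω => g (Y ω)) μ :=
  Integrable.of_finite.comp_measurable hY.measurable

theorem measureReal_mem (hY : IsDPP P K Y) (i : Fin d) : P.real {ω | i ∈ Y ω} = K i i := by
  simpa [det_unique, Finset.default_singleton] using hY.marginal {i}

theorem integral_card [IsFiniteMeasure P] (hY : IsDPP P K Y) :
    ∫ ω, ((Y ω).card : ℝ) ∂P = K.trace := by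
  have hmeas : ∀ i, MeasurableSet {ω | i ∈ Y ω} := fun i => hY.measurableSet_setOf (i ∈ ·)
  have hcard : ∀ ω, ((Y ω).card : ℝ) = ∑ i, {ω | i ∈ Y ω}.indicator (fun _ => (1 : ℝ)) ω := by
    simp [Set.indicator_apply]
  simp only [hcard]
  rw [integral_finsetSum _ fun i _ => (integrable_const _).indicator (hmeas i)]
  refine Finset.sum_congr rfl fun i _ => ?_
  rw [integral_indicator_const _ (hmeas i), smul_eq_mul, mul_one, hY.measureReal_mem, diag_apply]

theorem card_le_rank [IsFiniteMeasure P] (hY : IsDPP P K Y) :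
    ∀ᵐ ω ∂P, (Y ω).card ≤ K.rank := by
  have hnull : ∀ s : Finset (Fin d), K.rank < s.card → ∀ᵐ ω ∂P, ¬ s ⊆ Y ω := by
    intro s hs
    have hdet : (K.submatrix ((↑) : s → Fin d) ((↑) : s → Fin d)).det = 0 := by
      by_contra hne
      have := (rank_of_det_ne_zero hne).symm.trans_le (rank_submatrix_le K _ _)
      rw [Fintype.card_coe] at this
      exact hs.not_ge this
    exact measure_eq_zero_iff_ae_notMem.mp
      ((measureReal_eq_zero_iff).mp ((hY.marginal s).trans hdet))
  have hall : ∀ᵐ ω ∂P, ∀ s : Finset (Fin d), K.rank < s.card → ¬ s ⊆ Y ω := by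
    simpa only [ae_all_iff, Filter.eventually_imp_distrib_left] using hnull
  filter_upwards [hall] with ω hω
  exact not_lt.mp fun h => hω _ h subset_rfl

theorem card_eq_of_rank_le_trace [IsProbabilityMeasure P] (hY : IsDPP P K Y)
    (hK : (K.rank : ℝ) ≤ K.trace) : ∀ᵐ ω ∂P, (Y ω).card = K.rank := by
  have hgap : 0 ≤ᵐ[P] fun ω => (K.rank : ℝ) - (Y ω).card := by
    filter_upwards [hY.card_le_rank] with ω hω
    exact sub_nonneg.mpr (Nat.cast_le.mpr hω)
  have hmean : ∫ ω, ((K.rank : ℝ) - (Y ω).card) ∂P = K.rank - K.trace := by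
    rw [integral_sub (integrable_const _) (hY.integrable_comp P fun s => (s.card : ℝ)),
      hY.integral_card]
    simp
  have hzero := (integral_eq_zero_iff_of_nonneg_ae hgap
    (hY.integrable_comp P fun s => (K.rank : ℝ) - s.card)).mp
    (le_antisymm (hmean.trans_le (sub_nonpos.mpr hK)) (integral_nonneg_of_ae hgap))
  filter_upwards [hzero] with ω hω
  exact_mod_cast (sub_eq_zero.mp hω).symm

end Kernel

section Projection

variable [IsProbabilityMeasure P] {V : Matrix (Fin d) (Fin k) ℝ} {Y : Ω → Finset (Fin d)}

theorem card_eq (hY : IsDPP P (V * Vᵀ) Y) (hV : Vᵀ * V = 1) : ∀ᵐ ω ∂P, (Y ω).card = k := by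
  have htrace : (V * Vᵀ).trace = k := by rw [trace_mul_comm, hV, trace_one, Fintype.card_fin]
  have hrank : (V * Vᵀ).rank = k := by
    rw [rank_self_mul_transpose, ← rank_transpose_mul_self, hV, rank_one, Fintype.card_fin]
  simpa only [hrank] using hY.card_eq_of_rank_le_trace (by rw [hrank, htrace])

theorem measureReal_preimage_singleton (hY : IsDPP P (V * Vᵀ) Y) (hV : Vᵀ * V = 1)
    {s : Finset (Fin d)} (hs : s.card = k) : P.real (Y ⁻¹' {s}) = (rowGram V s).det := by
  rw [← det_submatrix_mul_transpose hs, ← hY.marginal s]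
  refine measureReal_congr ?_
  filter_upwards [hY.card_eq hV] with ω hω
  exact propext ⟨fun h : Y ω = s => h.ge,
    fun h : s ⊆ Y ω => (Finset.eq_of_subset_of_card_le h (hω.trans hs.symm).le).symm⟩

theorem det_rowGram_ne_zero (hY : IsDPP P (V * Vᵀ) Y) (hV : Vᵀ * V = 1) :
    ∀ᵐ ω ∂P, (rowGram V (Y ω)).det ≠ 0 := by
  have hnull : ∀ s : Finset (Fin d), s.card = k → (rowGram V s).det = 0 → ∀ᵐ ω ∂P, Y ω ≠ s := by
    intro s hs hdet
    exact measure_eq_zero_iff_ae_notMem.mp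
      ((measureReal_eq_zero_iff).mp ((hY.measureReal_preimage_singleton hV hs).trans hdet))
  have hall : ∀ᵐ ω ∂P, ∀ s : Finset (Fin d), s.card = k → (rowGram V s).det = 0 → Y ω ≠ s := by
    simpa only [ae_all_iff, Filter.eventually_imp_distrib_left] using hnull
  filter_upwards [hall, hY.card_eq hV] with ω hω hcard hdet
  exact hω _ hcard hdet rfl

theorem setIntegral_subset (hY : IsDPP P (V * Vᵀ) Y) (hV : Vᵀ * V = 1) (L : Finset (Fin d))
    (g : Finset (Fin d) → ℝ) :
    ∫ ω in {ω | Y ω ⊆ L}, g (Y ω) ∂P = ∑ s ∈ L.powersetCard k, (rowGram V s).det * g s := by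
  have hevent : {ω | Y ω ⊆ L} =ᵐ[P] Y ⁻¹' (L.powersetCard k) := by
    filter_upwards [hY.card_eq hV] with ω hω
    exact propext ⟨fun h : Y ω ⊆ L => Finset.mem_powersetCard.mpr ⟨h, hω⟩,
      fun h => (Finset.mem_powersetCard.mp h).1⟩
  rw [setIntegral_congr_set hevent, ← setIntegral_map (Finset.measurableSet _)
    Integrable.of_finite.aestronglyMeasurable hY.measurable.aemeasurable,
    setIntegral_finset _ Integrable.of_finite]
  refine Finset.sum_congr rfl fun s hs => ?_
  rw [map_measureReal_apply hY.measurable (measurableSet_singleton s),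
    hY.measureReal_preimage_singleton hV (Finset.mem_powersetCard.mp hs).2, smul_eq_mul]

theorem measureReal_subset (hY : IsDPP P (V * Vᵀ) Y) (hV : Vᵀ * V = 1) (L : Finset (Fin d)) :
    P.real {ω | Y ω ⊆ L} = (rowGram V L).det := by
  simpa [det_rowGram_eq_sum_powersetCard V L] using hY.setIntegral_subset hV L fun _ => 1

theorem integral_cond_subset (hY : IsDPP P (V * Vᵀ) Y) (hV : Vᵀ * V = 1) (L : Finset (Fin d))
    (g : Finset (Fin d) → ℝ) : ∫ ω, g (Y ω) ∂(P[|{ω | Y ω ⊆ L}]) =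
      (rowGram V L).det⁻¹ * ∑ s ∈ L.powersetCard k, (rowGram V s).det * g s := by
  rw [ProbabilityTheory.cond, integral_smul_measure, hY.setIntegral_subset hV, ENNReal.toReal_inv,
    smul_eq_mul, ← measureReal_def, hY.measureReal_subset hV]

theorem integral_cond_trace_inv_le (hY : IsDPP P (V * Vᵀ) Y) (hV : Vᵀ * V = 1)
    {L : Finset (Fin d)} (hL : (rowGram V L).det ≠ 0) :
    ∫ ω, (rowGram V (Y ω))⁻¹.trace ∂(P[|{ω | Y ω ⊆ L}]) ≤
      ((L.card : ℝ) - k + 1) * (rowGram V L)⁻¹.trace := by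
  have hpos : 0 < (rowGram V L).det := (posSemidef_rowGram V L).det_nonneg.lt_of_ne' hL
  rw [hY.integral_cond_subset hV L fun s => (rowGram V s)⁻¹.trace, inv_mul_le_iff₀ hpos,
    mul_left_comm]
  exact sum_det_mul_trace_inv_rowGram_le hL

theorem integral_cond_le_of_le_trace_inv (hY : IsDPP P (V * Vᵀ) Y) (hV : Vᵀ * V = 1)
    {L : Finset (Fin d)} (hL : (rowGram V L).det ≠ 0) {g : Finset (Fin d) → ℝ} {α β : ℝ}
    (hα : 0 ≤ α) (hg : ∀ s, s.card = k → (rowGram V s).det ≠ 0 →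
      g s ≤ α * (1 + (rowGram V s)⁻¹.trace) + β) :
    ∫ ω, g (Y ω) ∂(P[|{ω | Y ω ⊆ L}]) ≤
      α * (1 + ((L.card : ℝ) - k + 1) * (rowGram V L)⁻¹.trace) + β := by
  have hevent : P {ω | Y ω ⊆ L} ≠ 0 := fun h => hL <| by
    rw [← hY.measureReal_subset hV, measureReal_def, h, ENNReal.toReal_zero]
  have := cond_isProbabilityMeasure hevent
  have hae : ∀ᵐ ω ∂(P[|{ω | Y ω ⊆ L}]), g (Y ω) ≤ α * (1 + (rowGram V (Y ω))⁻¹.trace) + β := by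
    filter_upwards [cond_absolutelyContinuous.ae_le (hY.card_eq hV),
      cond_absolutelyContinuous.ae_le (hY.det_rowGram_ne_zero hV)] with ω hcard hdet
    exact hg _ hcard hdet
  have hint := hY.integrable_comp (P[|{ω | Y ω ⊆ L}])
  calc _ ≤ ∫ ω, (α * (1 + (rowGram V (Y ω))⁻¹.trace) + β) ∂(P[|{ω | Y ω ⊆ L}]) :=
        integral_mono_ae (hint g) (hint fun s => α * (1 + (rowGram V s)⁻¹.trace) + β) hae
    _ = α * (1 + ∫ ω, (rowGram V (Y ω))⁻¹.trace ∂(P[|{ω | Y ω ⊆ L}])) + β := by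
        rw [integral_add (hint fun s => α * (1 + (rowGram V s)⁻¹.trace)) (integrable_const β),
          integral_const_mul, integral_add (integrable_const 1)
            (hint fun s => (rowGram V s)⁻¹.trace)]
        simp
    _ ≤ _ := by
        gcongr
        exact hY.integral_cond_trace_inv_le hV hL

end Projection

end IsDPP

end DeterminantalPointProcess

section EffectiveSparsity

variable {d : ℕ}

/-- The indices that `π` ranks among the first `q` ones. -/
def head (π : Equiv.Perm (Fin d)) (q : ℕ) : Finset (Fin d) :=
  (Finset.univ.filter (fun i : Fin d => (i : ℕ) < q)).map π.toEmbedding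

theorem disjoint_tail_iff_subset_head (π : Equiv.Perm (Fin d)) (q : ℕ) (s : Finset (Fin d)) :
    Disjoint s (tail π q) ↔ s ⊆ head π q := by
  simp [Finset.disjoint_left, Finset.subset_iff, head, tail]

theorem card_head (π : Equiv.Perm (Fin d)) {q : ℕ} (hq : q ≤ d) : (head π q).card = q := by
  rw [head, Finset.card_map, Fin.card_filter_val_lt, min_eq_right hq]

theorem sum_head {M : Type*} [AddCommMonoid M] (π : Equiv.Perm (Fin d)) (q : ℕ) (f : Fin d → M) :
    ∑ j ∈ head π q, f j = ∑ i ∈ Finset.univ.filter (fun i : Fin d => (i : ℕ) < q), f (π i) :=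
  Finset.sum_map _ _ _

theorem effSparsity_spec {k : ℕ} (hd : 0 < d) {ℓ : Fin d → ℝ} {θ : ℝ}
    (hℓ : (k : ℝ) - 1 + 1 / θ ≤ ∑ j, ℓ j) (π : Equiv.Perm (Fin d)) :
    effSparsity k ℓ π θ ≤ d ∧
      (k : ℝ) - 1 + 1 / θ ≤ ∑ j ∈ head π (effSparsity k ℓ π θ), ℓ j := by
  have hmem := Nat.sInf_mem (s := {q : ℕ | 1 ≤ q ∧ q ≤ d ∧ (k : ℝ) - 1 + 1 / θ ≤
    ∑ i ∈ Finset.univ.filter (fun i : Fin d => (i : ℕ) < q), ℓ (π i)}) ⟨d, hd, le_rfl, by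
      rwa [Finset.filter_true_of_mem fun i _ => i.2, Equiv.sum_comp π]⟩
  exact ⟨hmem.2.1, hmem.2.2.trans_eq (sum_head π _ ℓ).symm⟩

theorem effSparsity_leverage_spec {k : ℕ} (hk : 0 < k) {V : Matrix (Fin d) (Fin k) ℝ}
    (hV : Vᵀ * V = 1) {θ : ℝ} (hθ : 1 ≤ θ) (π : Equiv.Perm (Fin d)) :
    effSparsity k (leverage V) π θ ≤ d ∧
      (k : ℝ) - 1 + 1 / θ ≤ ∑ j ∈ head π (effSparsity k (leverage V) π θ), leverage V j := by
  have hd : 0 < d := by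
    by_contra! hd0
    obtain rfl := Nat.le_zero.mp hd0
    have h := sum_leverage hV
    rw [Finset.univ_eq_empty, Finset.sum_empty] at h
    exact hk.ne (by exact_mod_cast h)
  refine effSparsity_spec hd ?_ π
  have : 1 / θ ≤ 1 := div_le_one_of_le₀ hθ (by linarith)
  linarith [sum_leverage hV]

end EffectiveSparsity

end ColumnSubset

end

theorem mainTheorem5_general {N d n m k : ℕ} (hN : 0 < N) (hkm : k ≤ m)
    (X : Matrix (Fin N) (Fin d) ℝ)
    (U : Matrix (Fin N) (Fin n) ℝ) (σ : ℕ → ℝ) (V : Matrix (Fin d) (Fin m) ℝ)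
    (hX : ColumnSubset.IsSVD X U σ V)
    (wstar : EuclideanSpace ℝ (Fin d)) (v : ℝ)
    {Ω' : Type*} [MeasurableSpace Ω'] (Q : Measure Ω') [IsProbabilityMeasure Q]
    (ξ : Fin N → Ω' → ℝ) (hξ : ColumnSubset.IsWhiteNoise Q ξ v)
    (θ : ℝ) (hθ : 0 < θ)
    {Ω : Type*} [MeasurableSpace Ω] (P : Measure Ω) [IsProbabilityMeasure P]
    (Y : Ω → Finset (Fin d))
    (hY : ColumnSubset.IsDPP P
      (ColumnSubset.firstCols V hkm * (ColumnSubset.firstCols V hkm)ᵀ) Y)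
    (L : Finset (Fin d))
    (hL : (k : ℝ) - 1 + 1 / θ ≤
      ∑ j ∈ L, ColumnSubset.leverage (ColumnSubset.firstCols V hkm) j) :
    0 < P {ω | Y ω ⊆ L} ∧
      ∫ ω, ColumnSubset.excessRisk Q ξ X wstar (ColumnSubset.sketchedLS X (Y ω))
          ∂(P[|{ω | Y ω ⊆ L}]) ≤
        (1 + ((k : ℝ) - 1 + θ) * ((L.card : ℝ) - (k : ℝ) + 1)) * (‖wstar‖ ^ 2 * σ k ^ 2 / N)
          + v * k / N := by
  have hVk := ColumnSubset.firstCols_transpose_mul_self hX.orthonormal_right hkm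
  have : Nonempty (Fin N) := ⟨⟨0, hN⟩⟩
  obtain ⟨hdet, htrace⟩ := ColumnSubset.det_rowGram_pos_and_trace_inv_le hVk hθ hL
  have hcard : (k : ℝ) ≤ L.card := by
    simpa using ColumnSubset.card_le_card_of_det_rowGram_ne_zero hdet.ne'
  refine ⟨(ENNReal.toReal_pos_iff.mp (hdet.trans_eq (hY.measureReal_subset hVk L).symm)).1, ?_⟩
  calc _ ≤ ‖wstar‖ ^ 2 * σ k ^ 2 / N * (1 + ((L.card : ℝ) - k + 1) *
            (ColumnSubset.rowGram (ColumnSubset.firstCols V hkm) L)⁻¹.trace) + v * k / N :=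
        hY.integral_cond_le_of_le_trace_inv hVk hdet.ne' (by positivity)
          fun s => hX.excessRisk_sketchedLS_le hkm hξ hξ.nonneg wstar
    _ ≤ ‖wstar‖ ^ 2 * σ k ^ 2 / N * (1 + ((L.card : ℝ) - k + 1) * ((k : ℝ) - 1 + θ)) +
          v * k / N := by gcongr
    _ = _ := by ring

theorem mainTheorem5 {N d n m k : ℕ} (hN : 0 < N) (hk : 0 < k) (hkm : k ≤ m)
    -- the data matrix and a singular value decomposition of it
    (X : Matrix (Fin N) (Fin d) ℝ)
    (U : Matrix (Fin N) (Fin n) ℝ) (σ : ℕ → ℝ) (V : Matrix (Fin d) (Fin m) ℝ)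
    (hX : ColumnSubset.IsSVD X U σ V)
    -- the linear model, with i.i.d. centred noise of variance `v`
    (wstar : EuclideanSpace ℝ (Fin d)) (v : ℝ)
    {Ω' : Type*} [MeasurableSpace Ω'] (Q : Measure Ω') [IsProbabilityMeasure Q]
    (ξ : Fin N → Ω' → ℝ) (hξ_indep : iIndepFun ξ Q)
    (hξ_ident : ∀ i j, IdentDistrib (ξ i) (ξ j) Q Q)
    (hξ_memLp : ∀ i, MemLp (ξ i) 2 Q)
    (hξ_mean : ∀ i, ∫ ω, ξ i ω ∂Q = 0) (hξ_var : ∀ i, variance (ξ i) Q = v)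
    -- a permutation that sorts the `k`-leverage scores, and the parameter `θ`
    (π : Equiv.Perm (Fin d))
    (hπ : Antitone fun i => ColumnSubset.leverage (ColumnSubset.firstCols V hkm) (π i))
    (θ : ℝ) (hθ : 1 < θ)
    -- the random subset, drawn from the projection DPP with marginal kernel `V_k V_kᵀ`
    {Ω : Type*} [MeasurableSpace Ω] (P : Measure Ω) [IsProbabilityMeasure P]
    (Y : Ω → Finset (Fin d))
    (hY : ColumnSubset.IsDPP P
      (ColumnSubset.firstCols V hkm * (ColumnSubset.firstCols V hkm)ᵀ) Y)
    -- the effective sparsity level and the conditioning event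
    (p : ℕ)
    (hp : p = ColumnSubset.effSparsity k
      (ColumnSubset.leverage (ColumnSubset.firstCols V hkm)) π θ)
    (A : Set Ω) (hA : A = {ω | Disjoint (Y ω) (ColumnSubset.tail π p)}) :
    0 < P A ∧
      ∫ ω, ColumnSubset.excessRisk Q ξ X wstar (ColumnSubset.sketchedLS X (Y ω)) ∂(P[|A]) ≤
        (1 + ((k : ℝ) - 1 + θ) * ((p : ℝ) - (k : ℝ) + 1)) * (‖wstar‖ ^ 2 * σ k ^ 2 / N)
          + v * k / N := by
  have hVk := ColumnSubset.firstCols_transpose_mul_self hX.orthonormal_right hkm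
  obtain ⟨hpd, hsum⟩ := ColumnSubset.effSparsity_leverage_spec hk hVk hθ.le π
  have hξ := ColumnSubset.IsWhiteNoise.of_iIndepFun hξ_indep hξ_memLp hξ_mean hξ_var
  subst hp hA
  simpa only [ColumnSubset.disjoint_tail_iff_subset_head, ColumnSubset.card_head π hpd] using
    mainTheorem5_general hN hkm X U σ V hX wstar v Q ξ hξ θ (zero_lt_one.trans hθ) P Y hY _ hsum
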